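/- **Setting.** Let $\mathcal G=(\mathcal V,\mathcal E,C)$ be a finite directed multigraph without self-loops, where link $e$ goes from $\sigma_e$ to $\tau_e$ and has flow capacity $C_e\in(0,+\infty]$. Let $\mathcal D$ be the set of destinations, i.e. nodes without outgoing links, let $\lambda\in\mathbb R_+^{\mathcal V\setminus\mathcal D}$ be a vector of external inflows, and let $\mathcal O=\{v:\lambda_v>0\}$ be the set of origins. Add a node $w$ (the external world), a link $e_v=(w,v)$ for each $v\in\mathcal O$ and a link $e^d=(d,w)$ for each $d\in\mathcal D$. Assume that $\mathcal D\neq\emptyset$ and that this augmented network is strongly connected. Let $B_e\in(0,+\infty)$, $e\in\mathcal E$, be finite buffer capacities. For a link $e$ in $\mathcal E$ or of the form $e_v$, let $\mathcal E_e^+$ be the set of links of the augmented network that leave the head node of $e$, and let $\mathcal E_e$ be the set of links of $\mathcal E$ that belong to $\mathcal E_e^+\cup\{e\}$. Let $\mathcal R_e^\bullet=\prod_{k\in\mathcal E_e}[0,B_k]\setminus\{(B_k)_{k\in\mathcal E_e}\}$ if the head of $e$ is not a destination, and $\mathcal R_e^\bullet=[0,B_e]$ if it is. A *distributed routing policy*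 is a family of locally Lipschitz maps $f^e=(f_{e\to j})_{j\in\mathcal E_e^+}:\mathcal R_e^\bullet\to\mathbb R_+^{\mathcal E_e^+}$, one for each $e\in\mathcal E\cup\{e_v:v\in\mathcal O\}$, whose total outflows $f_e^{\rm out}=\sum_{j\in\mathcal E_e^+}f_{e\to j}$ satisfy $f^{\rm out}_{e_v}\equiv\lambda_v$ for $v\in\mathcal O$ and, for $e\in\mathcal E$: $f_e^{\rm out}\le C_e$; $f_e^{\rm out}=0$ where $\rho_e=0$; $f_e^{\rm out}=C_e$ where $\rho_e=B_e$; and such that, for every $e$ and every $k\in\mathcal E_e^+\cap\mathcal E$, $f_{e\to k}=0$ where $\rho_k=B_k$. It is *monotone* if, for every $e$ and almost everywhere on $\mathcal R^\bullet_e$, $\partial f_{e\to j}/\partial\rho_k\ge0$ for all $j\in\mathcal E_e^+$ and $k\in\mathcal E_e\setminus\{j\}$, and $\partial f_e^{\rm out}/\partial\rho_k\le0$ for all $k\in\mathcal E_e^+\cap\mathcal E$. Let $\mathcal R=\prod_{e\in\mathcal E}[0,B_e)$. For $\rho^\circ\in\mathcal R$, consider the system $$\dot\rho_e=\sum_{i:\,e\in\mathcal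 E_i^+}f_{i\to e}(\rho^i)-f_e^{\rm out}(\rho^e),\quad e\in\mathcal E,\qquad \rho(0)=\rho^\circ,$$ where $\rho^i=(\rho_k)_{k\in\mathcal E_i}$, and let $\kappa(\rho^\circ)$ be the supremum of the times $T$ such that it has a solution on $[0,T)$ with values in $\mathcal R$. A *cut* is a non-empty set $\mathcal U\subseteq\mathcal V\setminus\mathcal D$. Put $\lambda_{\mathcal U}=\sum_{v\in\mathcal U}\lambda_v$, let $C_{\mathcal U}$ be the sum of $C_e$ over the links $e\in\mathcal E$ with $\sigma_e\in\mathcal U$ and $\tau_e\notin\mathcal U$, and let $\mathcal E_{\mathcal U}^+=\{e\in\mathcal E:\sigma_e\in\mathcal U\}$. **Proposition 1.** Let $f$ be a monotone distributed routing policy, and assume that $\lambda_{\mathcal U}>C_{\mathcal U}$ for some cut $\mathcal U$. Then, for every $\rho^\circ\in\mathcal R$, $$0<\kappa(\rho^\circ)\le\min_{\mathcal U:\,\lambda_{\mathcal U}>C_{\mathcal U}}\frac{\sum_{e\in\mathcal E_{\mathcal U}^+}(B_e-\rho_e^\circ)}{\lambda_{\mathcal U}-C_{\mathcal U}},$$ where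 the minimum is over cuts. The system has a unique solution $\rho(t)$ in $\mathcal R$ on $[0,\kappa(\rho^\circ))$, and there is a cut $\mathcal S$, possibly depending on $\rho^\circ$, such that $\lambda_{\mathcal S}>C_{\mathcal S}$, $\rho_e(t)<B_e$ for all $e\in\mathcal E$ and $0\le t<\kappa(\rho^\circ)$, and $\lim_{t\uparrow\kappa(\rho^\circ)}\rho_e(t)=B_e$ for every $e\in\mathcal E_{\mathcal S}^+$. -/

import Mathlib

open Set Filter Topology MeasureTheory
open scoped Classical

noncomputable section

/-- A finite directed multigraph without self-loops, with flow capacities in `(0, ∞]`, finite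
positive buffer capacities and a nonnegative vector of external inflows at the non-destination
nodes (extended by zero to the destination nodes, i.e. the nodes without outgoing links). -/
structure FlowNetwork (V E : Type*) where
  /-- the tail node of a link -/
  source : E → V
  /-- the head node of a link -/
  target : E → V
  loopless : ∀ e, target e ≠ source e
  /-- the flow capacity of a link -/
  cap : E → EReal
  cap_pos : ∀ e, 0 < cap e
  /-- the buffer capacity of a link -/
  buffer : E → ℝ
  buffer_pos : ∀ e, 0 < buffer e
  /-- the external inflow at a node -/
  inflow : V → ℝ
  inflow_nonneg : ∀ v, 0 ≤ inflow v
  inflow_dest : ∀ v, (∀ e, source e ≠ v) → inflow v = 0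

namespace FlowNetwork

variable {V E : Type*} [Fintype V] [Fintype E] (N : FlowNetwork V E)

/-- Destination nodes: nodes without outgoing links. -/
def IsDest (v : V) : Prop := ∀ e, N.source e ≠ v

/-- Origin nodes: nodes with positive external inflow. -/
def IsOrigin (v : V) : Prop := 0 < N.inflow v

/-- Adjacency in the augmented network, whose nodes are those of the network and one additional
node `none`, the external world: there is a link from it to each origin and a link from each
destination to it. -/
def AugAdj : Option V → Option V → Prop
  | some u, some v => ∃ e, N.source e = u ∧ N.target e = v
  | none, some v => N.IsOrigin v
  | some u, none => N.IsDest u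
  | none, none => False

/-- There is a destination, and the augmented network is strongly connected. -/
def Connected : Prop :=
  (∃ v, N.IsDest v) ∧ ∀ x y : Option V, Relation.ReflTransGen N.AugAdj x y

/-- A cut: a nonempty set of non-destination nodes. -/
def IsCut (U : Finset V) : Prop := U.Nonempty ∧ ∀ v ∈ U, ¬ N.IsDest v

/-- The capacity of `U`: the total capacity of the links that leave `U`. -/
def cutCap (U : Finset V) : EReal :=
  ∑ e ∈ Finset.univ.filter (fun e => N.source e ∈ U ∧ N.target e ∉ U), N.cap e

/-- The aggregate external inflow of `U`. -/
def cutInflow (U : Finset V) : ℝ := ∑ v ∈ U, N.inflow v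

/-- The set of links whose tail node is in `U`. -/
def linksFrom (U : Finset V) : Finset E := Finset.univ.filter fun e => N.source e ∈ U

/-- The cuts whose capacity is exceeded by their aggregate external inflow. -/
def violatedCuts : Finset (Finset V) :=
  Finset.univ.filter fun U => N.IsCut U ∧ N.cutCap U < (N.cutInflow U : EReal)

/-- The links of the augmented network that enter a node of the network: the links of the network,
and one link `inr v` from the external world for each origin `v`. -/
abbrev InLink : Type _ := E ⊕ {v : V // N.IsOrigin v}

/-- The links of the augmented network that leave a node of the network: the links of the network,
and one link `inr d` to the external world for each destination `d`. -/
abbrev OutLink : Type _ := E ⊕ {v : V // N.IsDest v}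

/-- The head node of a link. -/
def head : N.InLink → V := Sum.elim N.target Subtype.val

/-- The tail node of a link. -/
def tail : N.OutLink → V := Sum.elim N.source Subtype.val

/-- The links downstream of `i` in the augmented network. -/
abbrev Down (i : N.InLink) : Type _ := {j : N.OutLink // N.tail j = N.head i}

/-- The links of the network whose densities the flows out of `i` may depend on: `i` itself, if it
is a link of the network, and the links downstream of it. -/
abbrev Local (i : N.InLink) : Type _ := {k : E // Sum.inl k = i ∨ N.source k = N.head i}

instance (i : N.InLink) : Fintype (N.Down i) := Fintype.ofFinite _

instance (i : N.InLink) : Fintype (N.Local i) := Fintype.ofFinite _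

/-- The local density vectors around `i` that are allowed as arguments of the flow functions. If
the head node of `i` is not a destination, the point where all links around `i` are at
their buffer capacities is excluded. -/
def localDomain (i : N.InLink) : Set (N.Local i → ℝ) :=
  {x | (∀ k, 0 ≤ x k ∧ x k ≤ N.buffer k.1) ∧
    (¬ N.IsDest (N.head i) → ∃ k, x k ≠ N.buffer k.1)}

/-- A family of flow functions: the flow from `i` to each of its downstream links, as a function of
the local density vector around `i`. Values outside `localDomain` are irrelevant. -/
abbrev FlowFamily : Type _ := ∀ i : N.InLink, (N.Local i → ℝ) → N.Down i → ℝ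

variable {N}

/-- The total flow out of `i`. -/
def FlowFamily.outflow (f : N.FlowFamily) (i : N.InLink) (x : N.Local i → ℝ) : ℝ :=
  ∑ j, f i x j

/-- Distributed routing policies. -/
structure FlowFamily.IsRoutingPolicy (f : N.FlowFamily) : Prop where
  locallyLipschitzOn : ∀ i, LocallyLipschitzOn (N.localDomain i) (f i)
  nonneg : ∀ i, ∀ x ∈ N.localDomain i, ∀ j, 0 ≤ f i x j
  outflow_le : ∀ e : E, ∀ x ∈ N.localDomain (Sum.inl e),
    (f.outflow (Sum.inl e) x : EReal) ≤ N.cap e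
  outflow_origin : ∀ v, ∀ x ∈ N.localDomain (Sum.inr v), f.outflow (Sum.inr v) x = N.inflow v.1
  outflow_empty : ∀ e : E, ∀ x ∈ N.localDomain (Sum.inl e),
    x ⟨e, Or.inl rfl⟩ = 0 → f.outflow (Sum.inl e) x = 0
  outflow_full : ∀ e : E, ∀ x ∈ N.localDomain (Sum.inl e),
    x ⟨e, Or.inl rfl⟩ = N.buffer e → (f.outflow (Sum.inl e) x : EReal) = N.cap e
  flow_to_full : ∀ i, ∀ k : E, ∀ h : N.source k = N.head i, ∀ x ∈ N.localDomain i,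
    x ⟨k, Or.inr h⟩ = N.buffer k → f i x ⟨Sum.inl k, h⟩ = 0

/-- Monotonicity of a family of flow functions; the line derivative in the direction of a
standard basis vector is the partial derivative. -/
def FlowFamily.IsMonotone (f : N.FlowFamily) : Prop :=
  ∀ i : N.InLink, ∀ᵐ x ∂(volume.restrict (N.localDomain i)),
    (∀ (j : N.Down i) (k : N.Local i), j.1 ≠ Sum.inl k.1 →
      0 ≤ lineDeriv ℝ (fun y => f i y j) x (Pi.single k 1)) ∧
    (∀ k : N.Local i, N.source k.1 = N.head i →
      lineDeriv ℝ (f.outflow i) x (Pi.single k 1) ≤ 0)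

/-- The total flow into the link `e`. -/
def FlowFamily.inflowTo (f : N.FlowFamily) (r : E → ℝ) (e : E) : ℝ :=
  ∑ i : {i : N.InLink // N.head i = N.source e}, f i.1 (fun k => r k.1) ⟨Sum.inl e, i.2.symm⟩

/-- The right-hand side of the differential equation. -/
def FlowFamily.field (f : N.FlowFamily) (r : E → ℝ) : E → ℝ := fun e =>
  f.inflowTo r e - f.outflow (Sum.inl e) (fun k => r k.1)

variable (N) in
/-- The state space: nonnegative densities, strictly below the buffer capacities. -/
def stateSpace : Set (E → ℝ) := {r | ∀ e, 0 ≤ r e ∧ r e < N.buffer e}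

/-- The time interval `[0, T)`. -/
def timeInterval (T : EReal) : Set ℝ := {t | 0 ≤ t ∧ (t : EReal) < T}

/-- `ρ` solves the differential equation on `[0, T)` in the state space, starting from `r₀`. -/
def FlowFamily.IsSolution (f : N.FlowFamily) (r₀ : E → ℝ) (T : EReal) (ρ : ℝ → E → ℝ) : Prop :=
  ρ 0 = r₀ ∧ ∀ t ∈ timeInterval T, ρ t ∈ N.stateSpace ∧
    HasDerivWithinAt ρ (f.field (ρ t)) (timeInterval T) t

/-- The time up to which the solution from `r₀` is defined and stays in the state space. -/
def FlowFamily.exitTime (f : N.FlowFamily) (r₀ : E → ℝ) : EReal :=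
  sSup {T | ∃ ρ, f.IsSolution r₀ T ρ}

end FlowNetwork

end

/-!
Every violated cut bounds the times up to which a solution exists: the links that leave its nodes
gain mass at least at the rate by which the inflow of the cut exceeds its capacity
(`cutInflow_sub_le_sum_field`), while their buffers are finite. On every box `∏ e, [0, b e]` inside
the state space the right-hand side is Lipschitz, so composing it with the projection to the box
gives a system with global, unique solutions. These are nonnegative and solve the original system
as long as they stay in the box. This yields uniqueness, a solution on a maximal interval `[0, K)`,
and the fact that a solution with a limit inside the state space can be continued. The flows are
bounded, because a routing policy can exist only if all flow capacities are finite, hence the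
maximal solution has a limit `r'` at `K`, and some link is full at `r'`.

The cut is the set `S` of congested nodes, the non-destinations all of whose outgoing links are full
at `r'`. To see that its inflow exceeds its capacity, let `m` be the deficit, i.e. the total free
space on the links that are full at `r'`. Away from the excluded corner of their domain the flow
functions are Lipschitz, so filling up these links changes the flows by `O(m)` (`isBigO_flow_sub`).
Hence, up to `O(m)`, no flow enters `S` from links that are not full, no flow enters a full link
that starts at a node outside `S`, and a link that leaves `S` releases its capacity. Mass balance
over all full links then gives `-m' ≤ λ_S - C_S + O(m)` (`exists_sum_field_le`). If `λ_S ≤ C_S`,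
then `-m' ≤ c * m`, so that the positive function `m` could not reach zero at time `K`
(`not_tendsto_zero_of_deriv_ge`). In particular `S` is not empty, since otherwise
`λ_S = C_S = 0`.
-/

noncomputable section

namespace FlowNetwork

section

variable {V E : Type*} {N : FlowNetwork V E}

/-! ### Local densities and link flows -/

theorem restrict_mem_localDomain {i : N.InLink} {r : E → ℝ}
    (hr : ∀ e, 0 ≤ r e ∧ r e ≤ N.buffer e)
    (h : ¬ N.IsDest (N.head i) →
      ∃ k, (Sum.inl k = i ∨ N.source k = N.head i) ∧ r k ≠ N.buffer k) :
    (fun k : N.Local i => r k.1) ∈ N.localDomain i := by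
  refine ⟨fun k => hr k.1, fun hi => ?_⟩
  obtain ⟨k, hk, hne⟩ := h hi
  exact ⟨⟨k, hk⟩, hne⟩

theorem exists_link_of_not_isDest {v : V} (h : ¬ N.IsDest v) : ∃ e, N.source e = v := by
  unfold IsDest at h
  push Not at h
  exact h

theorem restrict_mem_localDomain_of_mem_stateSpace (i : N.InLink) {r : E → ℝ}
    (hr : r ∈ N.stateSpace) : (fun k : N.Local i => r k.1) ∈ N.localDomain i :=
  restrict_mem_localDomain (fun e => ⟨(hr e).1, (hr e).2.le⟩) fun hi => by
    obtain ⟨e, he⟩ := exists_link_of_not_isDest hi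
    exact ⟨e, Or.inr he, (hr e).2.ne⟩

/-- The flow from `i` to the link `e` at the state `r`, set to zero when `e` does not start at the
head of `i`, so that it can be summed over all pairs. -/
def FlowFamily.linkFlow (f : N.FlowFamily) (r : E → ℝ) (i : N.InLink) (e : E) : ℝ :=
  if h : N.source e = N.head i then f i (fun k => r k.1) ⟨Sum.inl e, h⟩ else 0

theorem FlowFamily.linkFlow_of_ne {f : N.FlowFamily} {r : E → ℝ} {i : N.InLink} {e : E}
    (h : N.source e ≠ N.head i) : f.linkFlow r i e = 0 := dif_neg h

/-! ### Bounds on the flows -/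

variable [Fintype V] [Fintype E]

/-- A routing policy forces every flow capacity to be finite: for each link there is an admissible
local density vector at which the link is full, and there its real-valued outflow is the
capacity. -/
theorem FlowFamily.IsRoutingPolicy.coe_toReal_cap {f : N.FlowFamily} (hf : f.IsRoutingPolicy)
    (e : E) : ((N.cap e).toReal : EReal) = N.cap e := by
  have hmem : (fun k : N.Local (Sum.inl e) => if k.1 = e then N.buffer e else 0) ∈
      N.localDomain (Sum.inl e) := by
    refine restrict_mem_localDomain (r := fun k => if k = e then N.buffer e else 0)
      (fun k => ?_) fun hi => ?_
    · by_cases hk : k = e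
      · subst hk
        simp [(N.buffer_pos k).le]
      · simp [hk, (N.buffer_pos k).le]
    · obtain ⟨k, hk⟩ := exists_link_of_not_isDest hi
      have hke : k ≠ e := by
        rintro rfl
        exact N.loopless k hk.symm
      exact ⟨k, Or.inr hk, by simpa [hke] using (N.buffer_pos k).ne⟩
  have h := hf.outflow_full e _ hmem (by simp)
  rw [← h, EReal.toReal_coe]

theorem FlowFamily.IsRoutingPolicy.outflow_le_toReal_cap {f : N.FlowFamily}
    (hf : f.IsRoutingPolicy) (e : E) {x : N.Local (Sum.inl e) → ℝ}
    (hx : x ∈ N.localDomain (Sum.inl e)) :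
    f.outflow (Sum.inl e) x ≤ (N.cap e).toReal := by
  have h := hf.outflow_le e x hx
  rw [← hf.coe_toReal_cap e] at h
  exact_mod_cast h

theorem FlowFamily.IsRoutingPolicy.outflow_nonneg {f : N.FlowFamily}
    (hf : f.IsRoutingPolicy) (i : N.InLink) {x : N.Local i → ℝ} (hx : x ∈ N.localDomain i) :
    0 ≤ f.outflow i x :=
  Finset.sum_nonneg fun j _ => hf.nonneg i x hx j

theorem FlowFamily.IsRoutingPolicy.cutCap_eq {f : N.FlowFamily} (hf : f.IsRoutingPolicy)
    (U : Finset V) : N.cutCap U =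
      ((∑ e with N.source e ∈ U ∧ N.target e ∉ U, (N.cap e).toReal : ℝ) : EReal) := by
  rw [cutCap, Finset.sum_congr rfl fun e _ => (hf.coe_toReal_cap e).symm]
  induction Finset.univ.filter (fun e => N.source e ∈ U ∧ N.target e ∉ U) using
    Finset.induction_on with
  | empty => simp
  | insert e s he ih => rw [Finset.sum_insert he, Finset.sum_insert he, EReal.coe_add, ih]

theorem FlowFamily.IsRoutingPolicy.exists_outflow_le {f : N.FlowFamily}
    (hf : f.IsRoutingPolicy) :
    ∃ M : ℝ, ∀ i : N.InLink, ∀ x ∈ N.localDomain i, f.outflow i x ≤ M := by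
  have h : ∀ i : N.InLink, ∃ m : ℝ, ∀ x ∈ N.localDomain i, f.outflow i x ≤ m := by
    rintro (e | v)
    · exact ⟨_, fun x hx => hf.outflow_le_toReal_cap e hx⟩
    · exact ⟨_, fun x hx => (hf.outflow_origin v x hx).le⟩
  choose m hm using h
  obtain ⟨M, hM⟩ := (Set.finite_range m).bddAbove
  exact ⟨M, fun i x hx => (hm i x hx).trans (hM ⟨i, rfl⟩)⟩

theorem FlowFamily.IsRoutingPolicy.inflowTo_nonneg {f : N.FlowFamily}
    (hf : f.IsRoutingPolicy) {r : E → ℝ} (hr : r ∈ N.stateSpace) (e : E) :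
    0 ≤ f.inflowTo r e :=
  Finset.sum_nonneg fun i _ =>
    hf.nonneg i.1 _ (restrict_mem_localDomain_of_mem_stateSpace i.1 hr) _

theorem FlowFamily.IsRoutingPolicy.exists_norm_field_le {f : N.FlowFamily}
    (hf : f.IsRoutingPolicy) : ∃ M : ℝ, ∀ r ∈ N.stateSpace, ‖f.field r‖ ≤ M := by
  obtain ⟨M, hM⟩ := hf.exists_outflow_le
  have hM' : ∀ i : N.InLink, ∀ x ∈ N.localDomain i, f.outflow i x ≤ |M| :=
    fun i x hx => (hM i x hx).trans (le_abs_self M)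
  refine ⟨(Fintype.card N.InLink + 1) * |M|, fun r hr => ?_⟩
  refine (pi_norm_le_iff_of_nonneg (by positivity)).2 fun e => ?_
  have hd := fun i => restrict_mem_localDomain_of_mem_stateSpace (N := N) i hr
  have h1 : f.inflowTo r e ≤ Fintype.card N.InLink * |M| := by
    calc f.inflowTo r e
        ≤ ∑ _i : {i : N.InLink // N.head i = N.source e}, |M| := by
          refine Finset.sum_le_sum fun i _ => le_trans ?_ (hM' i.1 _ (hd i.1))
          exact Finset.single_le_sum (f := fun j => f i.1 (fun k => r k.1) j)
            (fun j _ => hf.nonneg i.1 _ (hd i.1) j) (Finset.mem_univ _)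
      _ = Fintype.card {i : N.InLink // N.head i = N.source e} * |M| := by
          simp
      _ ≤ _ := by
          gcongr
          exact Fintype.card_subtype_le _
  have h2 := hf.inflowTo_nonneg hr e
  have h3 := hf.outflow_nonneg (Sum.inl e) (hd _)
  have h4 := hM' (Sum.inl e) _ (hd _)
  have h5 : 0 ≤ Fintype.card N.InLink * |M| := by positivity
  have h6 : 0 ≤ |M| := abs_nonneg M
  rw [Real.norm_eq_abs, abs_le]
  simp only [field]
  constructor <;> linarith

/-! ### Conservation of mass -/

theorem FlowFamily.inflowTo_eq_sum_linkFlow (f : N.FlowFamily) (r : E → ℝ) (e : E) :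
    f.inflowTo r e = ∑ i, f.linkFlow r i e := by
  rw [← Finset.sum_filter_of_ne (p := fun i => N.head i = N.source e)
      fun i _ hne => by_contra fun h => hne (linkFlow_of_ne (Ne.symm h)),
    Finset.sum_subtype (p := fun i => N.head i = N.source e) _ (by simp), inflowTo]
  exact Finset.sum_congr rfl fun i _ => by rw [linkFlow, dif_pos i.2.symm]

theorem FlowFamily.outflow_eq_sum_linkFlow (f : N.FlowFamily) (r : E → ℝ) {i : N.InLink}
    (hi : ¬ N.IsDest (N.head i)) :
    f.outflow i (fun k => r k.1) = ∑ e, f.linkFlow r i e := by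
  rw [← Finset.sum_filter_of_ne (p := fun e => N.source e = N.head i)
      fun e _ hne => by_contra fun h => hne (linkFlow_of_ne h),
    Finset.sum_subtype (p := fun e => N.source e = N.head i) _ (by simp), outflow]
  symm
  refine Fintype.sum_bijective
    (fun e : {e // N.source e = N.head i} => (⟨Sum.inl e.1, e.2⟩ : N.Down i)) ⟨?_, ?_⟩ _ _
    fun e => dif_pos e.2
  · intro a b hab
    simpa [Subtype.ext_iff] using hab
  · rintro ⟨e | d, h⟩
    · exact ⟨⟨e, h⟩, rfl⟩
    · exact absurd (show N.IsDest (N.head i) from h ▸ d.2) hi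

/-- At the nodes of a set without destinations, what flows into the outgoing links is what the
incoming links release plus the external inflow. -/
theorem FlowFamily.IsRoutingPolicy.sum_inflowTo {f : N.FlowFamily} (hf : f.IsRoutingPolicy)
    {r : E → ℝ} (hr : r ∈ N.stateSpace) {U : Finset V} (hU : ∀ v ∈ U, ¬ N.IsDest v) :
    ∑ e ∈ N.linksFrom U, f.inflowTo r e =
      ∑ e with N.target e ∈ U, f.outflow (Sum.inl e) (fun k => r k.1) + N.cutInflow U := by
  have h1 : ∀ i : N.InLink, ∑ e ∈ N.linksFrom U, f.linkFlow r i e =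
      if N.head i ∈ U then f.outflow i (fun k => r k.1) else 0 := by
    intro i
    split_ifs with h
    · rw [f.outflow_eq_sum_linkFlow r (hU _ h), linksFrom]
      refine Finset.sum_filter_of_ne fun e _ hne => ?_
      by_contra hs
      exact hne (FlowFamily.linkFlow_of_ne fun he => hs (he ▸ h))
    · refine Finset.sum_eq_zero fun e he => FlowFamily.linkFlow_of_ne fun hs => h ?_
      rw [← hs]
      exact (Finset.mem_filter.1 he).2
  have h2 : ∑ v : {v // N.IsOrigin v},
      (if N.head (Sum.inr v) ∈ U then f.outflow (Sum.inr v) (fun k => r k.1) else 0) =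
      N.cutInflow U := by
    have h3 : ∀ v : {v // N.IsOrigin v},
        (if N.head (Sum.inr v) ∈ U then f.outflow (Sum.inr v) (fun k => r k.1) else 0) =
        if v.1 ∈ U then N.inflow v.1 else 0 := fun v => by
      rw [hf.outflow_origin v _ (restrict_mem_localDomain_of_mem_stateSpace _ hr)]
      rfl
    rw [Finset.sum_congr rfl fun v _ => h3 v,
      ← Finset.sum_subtype (p := N.IsOrigin) (Finset.univ.filter fun v => N.IsOrigin v)
        (by simp) (fun v => if v ∈ U then N.inflow v else 0),
      Finset.sum_filter_of_ne, Finset.sum_ite_mem, Finset.univ_inter, cutInflow]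
    intro v _ hne
    refine lt_of_le_of_ne (N.inflow_nonneg v) fun h => hne ?_
    simp [← h]
  simp_rw [f.inflowTo_eq_sum_linkFlow]
  rw [Finset.sum_comm, Finset.sum_congr rfl fun i _ => h1 i, Fintype.sum_sum_type, h2,
    Finset.sum_filter]
  rfl

/-- The total density on the links that leave the nodes of `U` grows at least at the rate by which
the external inflow of `U` exceeds its capacity. -/
theorem FlowFamily.IsRoutingPolicy.cutInflow_sub_le_sum_field {f : N.FlowFamily}
    (hf : f.IsRoutingPolicy) {r : E → ℝ} (hr : r ∈ N.stateSpace) {U : Finset V}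
    (hU : ∀ v ∈ U, ¬ N.IsDest v) :
    N.cutInflow U - ∑ e with N.source e ∈ U ∧ N.target e ∉ U, (N.cap e).toReal ≤
      ∑ e ∈ N.linksFrom U, f.field r e := by
  have hd := fun i => restrict_mem_localDomain_of_mem_stateSpace (N := N) i hr
  simp only [field, Finset.sum_sub_distrib]
  rw [hf.sum_inflowTo hr hU, linksFrom,
    ← Finset.sum_filter_add_sum_filter_not (Finset.univ.filter fun e => N.source e ∈ U)
      (fun e => N.target e ∈ U), Finset.filter_filter, Finset.filter_filter]
  have h1 : ∑ e with N.source e ∈ U ∧ N.target e ∈ U, f.outflow (Sum.inl e) (fun k => r k.1) ≤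
      ∑ e with N.target e ∈ U, f.outflow (Sum.inl e) (fun k => r k.1) :=
    Finset.sum_le_sum_of_subset_of_nonneg (fun e => by simp +contextual)
      fun e _ _ => hf.outflow_nonneg _ (hd _)
  have h2 : ∑ e with N.source e ∈ U ∧ N.target e ∉ U, f.outflow (Sum.inl e) (fun k => r k.1) ≤
      ∑ e with N.source e ∈ U ∧ N.target e ∉ U, (N.cap e).toReal :=
    Finset.sum_le_sum fun e _ => hf.outflow_le_toReal_cap e (hd _)
  linarith

end

section

variable {V E : Type*} {N : FlowNetwork V E}

/-! ### The system with clamped densities -/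

theorem exists_lipschitzWith_sum {α ι F : Type*} [PseudoMetricSpace α]
    [SeminormedAddCommGroup F] (s : Finset ι) {g : ι → α → F}
    (h : ∀ i, ∃ K, LipschitzWith K (g i)) : ∃ K, LipschitzWith K fun x => ∑ i ∈ s, g i x := by
  induction s using Finset.induction_on with
  | empty => exact ⟨0, by simpa using LipschitzWith.const (0 : F)⟩
  | insert i s hi ih =>
    obtain ⟨K, hK⟩ := ih
    obtain ⟨L, hL⟩ := h i
    exact ⟨L + K, by simpa only [Finset.sum_insert hi] using hL.add hK⟩

theorem exists_lipschitzWith_pi {α ι : Type*} [Fintype ι] [PseudoMetricSpace α]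
    {g : α → ι → ℝ} (h : ∀ i, ∃ K, LipschitzWith K fun x => g x i) :
    ∃ K, LipschitzWith K g := by
  choose K hK using h
  refine ⟨∑ i, K i, fun x y => edist_pi_le_iff.2 fun i => (hK i x y).trans ?_⟩
  gcongr
  exact Finset.single_le_sum (f := K) (fun _ _ => bot_le) (Finset.mem_univ i)

/-- The coordinatewise projection to the box `∏ e, [0, b e]`. -/
def clamp (b r : E → ℝ) : E → ℝ := fun e => max 0 (min (r e) (b e))

theorem clamp_eq_self {b r : E → ℝ} (h : ∀ e, 0 ≤ r e ∧ r e ≤ b e) : clamp b r = r :=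
  funext fun e => by rw [clamp, min_eq_left (h e).2, max_eq_right (h e).1]

theorem clamp_mem_Icc {b : E → ℝ} (hb : ∀ e, 0 ≤ b e) (r : E → ℝ) (e : E) :
    clamp b r e ∈ Icc 0 (b e) :=
  ⟨le_max_left _ _, max_le (hb e) (min_le_right _ _)⟩

theorem clamp_mem_stateSpace {b : E → ℝ} (hb : ∀ e, 0 ≤ b e ∧ b e < N.buffer e) (r : E → ℝ) :
    clamp b r ∈ N.stateSpace := fun e =>
  have h := clamp_mem_Icc (fun e => (hb e).1) r e
  ⟨h.1, h.2.trans_lt (hb e).2⟩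

/-- A continuous curve over a compact interval that stays strictly below the buffer capacities
stays uniformly below them. -/
theorem exists_box {x : ℝ → E → ℝ} {T : ℝ} (hT : 0 ≤ T) (hx : ContinuousOn x (Icc 0 T))
    (hm : ∀ t ∈ Icc 0 T, x t ∈ N.stateSpace) :
    ∃ b : E → ℝ, (∀ e, 0 ≤ b e ∧ b e < N.buffer e) ∧ ∀ t ∈ Icc 0 T, ∀ e, x t e < b e := by
  have h : ∀ e, ∃ b, (0 ≤ b ∧ b < N.buffer e) ∧ ∀ t ∈ Icc 0 T, x t e < b := by
    intro e
    obtain ⟨s, hs, hmax⟩ := isCompact_Icc.exists_isMaxOn (nonempty_Icc.2 hT)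
      (continuousOn_pi.1 hx e)
    have h1 := hm s hs e
    refine ⟨(x s e + N.buffer e) / 2, ⟨?_, ?_⟩, fun t ht => ?_⟩
    · linarith [h1.1, h1.2]
    · linarith [h1.2]
    · have : x t e ≤ x s e := hmax ht
      linarith [h1.2]
  choose b hb using h
  exact ⟨b, fun e => (hb e).1, fun t ht e => (hb e).2 t ht⟩

variable [Fintype V] [Fintype E]

theorem lipschitzWith_clamp_apply (b : E → ℝ) (e : E) :
    LipschitzWith 1 fun r : E → ℝ => clamp b r e :=
  ((LipschitzWith.eval e).min_const (b e)).const_max 0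

/-- The right-hand side of the system, precomposed with the projection to a box inside the state
space. It is globally Lipschitz and bounded, and it agrees with the right-hand side on the box. -/
def FlowFamily.clampedField (f : N.FlowFamily) (b r : E → ℝ) : E → ℝ := f.field (clamp b r)

theorem FlowFamily.IsRoutingPolicy.exists_lipschitzWith_clampedField {f : N.FlowFamily}
    (hf : f.IsRoutingPolicy) {b : E → ℝ} (hb : ∀ e, 0 ≤ b e ∧ b e < N.buffer e) :
    ∃ K, LipschitzWith K (f.clampedField b) := by
  have h1 : ∀ i : N.InLink, ∃ K, LipschitzWith K
      fun r : E → ℝ => f i (fun k => clamp b r k.1) := by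
    intro i
    have hsub : (Set.pi univ fun k : N.Local i => Icc 0 (b k.1)) ⊆ N.localDomain i := by
      intro x hx
      have hx' := fun k => hx k (mem_univ k)
      refine ⟨fun k => ⟨(hx' k).1, (hx' k).2.trans (hb k.1).2.le⟩, fun hi => ?_⟩
      obtain ⟨e, he⟩ := exists_link_of_not_isDest hi
      exact ⟨⟨e, Or.inr he⟩, ((hx' ⟨e, Or.inr he⟩).2.trans_lt (hb e).2).ne⟩
    obtain ⟨K, hK⟩ := LocallyLipschitzOn.exists_lipschitzOnWith_of_compact
      (isCompact_univ_pi fun k : N.Local i => isCompact_Icc)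
      ((hf.locallyLipschitzOn i).mono hsub)
    refine ⟨K, LipschitzWith.of_dist_le_mul fun r r' => ?_⟩
    have hm : ∀ r : E → ℝ, (fun k : N.Local i => clamp b r k.1) ∈
        Set.pi univ fun k : N.Local i => Icc 0 (b k.1) :=
      fun r k _ => clamp_mem_Icc (fun e => (hb e).1) r k.1
    refine (hK.dist_le_mul _ (hm r) _ (hm r')).trans ?_
    gcongr
    refine (dist_pi_le_iff dist_nonneg).2 fun k => ?_
    simpa using (lipschitzWith_clamp_apply b k.1).dist_le_mul r r'
  have h2 : ∀ i (j : N.Down i), ∃ K, LipschitzWith K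
      fun r : E → ℝ => f i (fun k => clamp b r k.1) j := fun i j => by
    obtain ⟨K, hK⟩ := h1 i
    exact ⟨1 * K, (LipschitzWith.eval j).comp hK⟩
  refine exists_lipschitzWith_pi fun e => ?_
  obtain ⟨K, hK⟩ := exists_lipschitzWith_sum Finset.univ
    fun i : {i : N.InLink // N.head i = N.source e} => h2 i.1 ⟨Sum.inl e, i.2.symm⟩
  obtain ⟨L, hL⟩ := exists_lipschitzWith_sum Finset.univ fun j => h2 (Sum.inl e) j
  exact ⟨K + L, hK.sub hL⟩

theorem FlowFamily.IsRoutingPolicy.exists_clamped_solution {f : N.FlowFamily}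
    (hf : f.IsRoutingPolicy) {b : E → ℝ} (hb : ∀ e, 0 ≤ b e ∧ b e < N.buffer e)
    (r₀ : E → ℝ) {T : ℝ} (hT : 0 ≤ T) :
    ∃ x : ℝ → E → ℝ, x 0 = r₀ ∧
      ∀ t ∈ Icc 0 T, HasDerivWithinAt x (f.clampedField b (x t)) (Icc 0 T) t := by
  obtain ⟨K, hK⟩ := hf.exists_lipschitzWith_clampedField hb
  obtain ⟨M, hM⟩ := hf.exists_norm_field_le
  have hP : IsPicardLindelof (fun _ => f.clampedField b) (⟨0, le_rfl, hT⟩ : Icc 0 T) r₀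
      (M.toNNReal * T.toNNReal) 0 M.toNNReal K :=
    IsPicardLindelof.of_time_independent
      (fun r _ => (hM _ (clamp_mem_stateSpace hb r)).trans (Real.le_coe_toNNReal M))
      hK.lipschitzOnWith (by simp [hT])
  exact hP.exists_eq_forall_mem_Icc_hasDerivWithinAt₀

/-- Solutions of the clamped system stay nonnegative: where a coordinate is negative the clamped
density is zero, so that the link releases nothing. -/
theorem FlowFamily.IsRoutingPolicy.clamped_solution_nonneg {f : N.FlowFamily}
    (hf : f.IsRoutingPolicy) {b : E → ℝ} (hb : ∀ e, 0 ≤ b e ∧ b e < N.buffer e)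
    {x : ℝ → E → ℝ} {T : ℝ} (h0 : ∀ e, 0 ≤ x 0 e)
    (hx : ∀ t ∈ Icc 0 T, HasDerivWithinAt x (f.clampedField b (x t)) (Icc 0 T) t)
    {t : ℝ} (ht : t ∈ Icc 0 T) (e : E) : 0 ≤ x t e := by
  have hxe : ∀ t ∈ Icc 0 T,
      HasDerivWithinAt (fun s => x s e) (f.clampedField b (x t) e) (Icc 0 T) t :=
    fun t ht => hasDerivWithinAt_pi.1 (hx t ht) e
  -- The comparison function `δ * (1 + t)` has a positive slope, so a strict inequality between
  -- the derivatives at a crossing point suffices; then `δ` tends to zero.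
  have key : ∀ δ : ℝ, 0 < δ → -x t e ≤ δ * (1 + t) := by
    intro δ hδ
    refine image_le_of_deriv_right_lt_deriv_boundary (f := fun s => -x s e)
      (f' := fun s => -f.clampedField b (x s) e) (B := fun s => δ * (1 + s)) (B' := fun _ => δ)
      (fun s hs => (hxe s hs).continuousWithinAt.neg)
      (fun s hs => ((hxe s (Ico_subset_Icc_self hs)).mono_of_mem_nhdsWithin
        (Icc_mem_nhdsGE_of_mem hs)).neg) ?_ ?_ ?_ ht
    · have := h0 e
      simp only [add_zero, mul_one]
      linarith
    · intro s
      simpa using ((hasDerivAt_id s).const_add 1).const_mul δ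
    · intro s hs hse
      have hneg : x s e < 0 := by
        have : 0 < δ * (1 + s) := mul_pos hδ (by linarith [hs.1])
        linarith
      have hm := clamp_mem_stateSpace hb (x s)
      have hz : clamp b (x s) e = 0 := max_eq_left ((min_le_left _ _).trans hneg.le)
      have h1 := hf.inflowTo_nonneg hm e
      have h2 := hf.outflow_empty e _ (restrict_mem_localDomain_of_mem_stateSpace _ hm) hz
      have h3 : 0 ≤ f.clampedField b (x s) e := by
        simpa [FlowFamily.clampedField, FlowFamily.field, h2] using h1
      linarith
  have hlim : Tendsto (fun δ : ℝ => δ * (1 + t)) (𝓝[>] 0) (𝓝 0) :=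
    ((continuous_mul_const (1 + t)).tendsto' 0 0 (zero_mul _)).mono_left nhdsWithin_le_nhds
  have := ge_of_tendsto hlim (eventually_mem_nhdsWithin.mono fun δ hδ => key δ hδ)
  linarith

theorem FlowFamily.IsRoutingPolicy.clamped_solution_unique {f : N.FlowFamily}
    (hf : f.IsRoutingPolicy) {b : E → ℝ} (hb : ∀ e, 0 ≤ b e ∧ b e < N.buffer e)
    {x y : ℝ → E → ℝ} {T : ℝ} (h0 : x 0 = y 0)
    (hx : ∀ t ∈ Icc 0 T, HasDerivWithinAt x (f.clampedField b (x t)) (Icc 0 T) t)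
    (hy : ∀ t ∈ Icc 0 T, HasDerivWithinAt y (f.clampedField b (y t)) (Icc 0 T) t) :
    EqOn x y (Icc 0 T) := by
  obtain ⟨K, hK⟩ := hf.exists_lipschitzWith_clampedField hb
  exact ODE_solution_unique (v := fun _ => f.clampedField b) (fun _ => hK)
    (fun t ht => (hx t ht).continuousWithinAt)
    (fun t ht => (hx t (Ico_subset_Icc_self ht)).mono_of_mem_nhdsWithin
      (Icc_mem_nhdsGE_of_mem ht))
    (fun t ht => (hy t ht).continuousWithinAt)
    (fun t ht => (hy t (Ico_subset_Icc_self ht)).mono_of_mem_nhdsWithin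
      (Icc_mem_nhdsGE_of_mem ht)) h0

/-! ### Local existence, uniqueness and extension of solutions -/

theorem timeInterval_coe (T : ℝ) : timeInterval (T : EReal) = Ico 0 T := by
  ext t
  simp [timeInterval]

theorem FlowFamily.IsSolution.mono {f : N.FlowFamily} {r₀ : E → ℝ} {S T : EReal}
    {ρ : ℝ → E → ℝ} (h : f.IsSolution r₀ T ρ) (hST : S ≤ T) : f.IsSolution r₀ S ρ := by
  have hsub : timeInterval S ⊆ timeInterval T := fun t ht => ⟨ht.1, ht.2.trans_le hST⟩
  exact ⟨h.1, fun t ht => ⟨(h.2 t (hsub ht)).1, (h.2 t (hsub ht)).2.mono hsub⟩⟩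

/-- While a solution stays in a box inside the state space, it also solves the clamped system. -/
theorem FlowFamily.IsSolution.clamped {f : N.FlowFamily} {r₀ : E → ℝ} {T : ℝ}
    {ρ : ℝ → E → ℝ} (h : f.IsSolution r₀ T ρ) {b : E → ℝ} {S : ℝ} (hST : S < T)
    (hb : ∀ t ∈ Icc 0 S, ∀ e, ρ t e ≤ b e) :
    ∀ t ∈ Icc 0 S, HasDerivWithinAt ρ (f.clampedField b (ρ t)) (Icc 0 S) t := by
  intro t ht
  have ht' : t ∈ timeInterval (T : EReal) := by
    rw [timeInterval_coe]
    exact ⟨ht.1, ht.2.trans_lt hST⟩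
  obtain ⟨hm, hd⟩ := h.2 t ht'
  rw [FlowFamily.clampedField, clamp_eq_self fun e => ⟨(hm e).1, hb t ht e⟩]
  refine hd.mono ?_
  rw [timeInterval_coe]
  exact fun s hs => ⟨hs.1, hs.2.trans_lt hST⟩

/-- On a compact time interval two solutions stay in a common box inside the state space, where the
system agrees with a clamped one. -/
theorem FlowFamily.IsRoutingPolicy.isSolution_unique {f : N.FlowFamily}
    (hf : f.IsRoutingPolicy) {r₀ : E → ℝ} {T : ℝ} {ρ ρ' : ℝ → E → ℝ}
    (h : f.IsSolution r₀ T ρ) (h' : f.IsSolution r₀ T ρ') : EqOn ρ ρ' (Ico 0 T) := by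
  intro t ht
  have hsub : Icc 0 t ⊆ timeInterval (T : EReal) := by
    rw [timeInterval_coe]
    exact fun s hs => ⟨hs.1, hs.2.trans_lt ht.2⟩
  have hbox : ∀ {σ : ℝ → E → ℝ}, f.IsSolution r₀ T σ → ∃ b : E → ℝ,
      (∀ e, 0 ≤ b e ∧ b e < N.buffer e) ∧ ∀ s ∈ Icc 0 t, ∀ e, σ s e < b e := fun hσ =>
    exists_box ht.1 (fun s hs => ((hσ.2 s (hsub hs)).2.mono hsub).continuousWithinAt)
      fun s hs => (hσ.2 s (hsub hs)).1
  obtain ⟨b, hb, hρ⟩ := hbox h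
  obtain ⟨b', hb', hρ'⟩ := hbox h'
  refine hf.clamped_solution_unique (b := fun e => max (b e) (b' e))
    (fun e => ⟨le_max_of_le_left (hb e).1, max_lt (hb e).2 (hb' e).2⟩) (h.1.trans h'.1.symm)
    (h.clamped ht.2 fun s hs e => (hρ s hs e).le.trans (le_max_left _ _))
    (h'.clamped ht.2 fun s hs e => (hρ' s hs e).le.trans (le_max_right _ _)) ⟨ht.1, le_rfl⟩

/-- A solution on `[0, K)` that extends continuously to `[0, K]` inside the state space can be
continued beyond `K`. For `K = 0` this is local existence. -/
theorem FlowFamily.IsRoutingPolicy.exists_isSolution_extend {f : N.FlowFamily}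
    (hf : f.IsRoutingPolicy) {r₀ : E → ℝ} {K : ℝ} (hK : 0 ≤ K) {g : ℝ → E → ℝ}
    (hg : ContinuousOn g (Icc 0 K)) (hm : ∀ t ∈ Icc 0 K, g t ∈ N.stateSpace) (hg0 : g 0 = r₀)
    (hsol : f.IsSolution r₀ K g) : ∃ T : ℝ, K < T ∧ ∃ ρ, f.IsSolution r₀ T ρ := by
  obtain ⟨b, hb, hgb⟩ := exists_box hK hg hm
  obtain ⟨x, hx0, hx⟩ := hf.exists_clamped_solution hb r₀ (T := K + 1) (by linarith)
  have hxc : ContinuousOn x (Icc 0 (K + 1)) := fun t ht => (hx t ht).continuousWithinAt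
  have heq : EqOn x g (Icc 0 K) := by
    rcases hK.eq_or_lt with rfl | hK'
    · intro t ht
      rw [Icc_self, mem_singleton_iff] at ht
      rw [ht, hx0, hg0]
    · have hIco : EqOn x g (Ico 0 K) := by
        intro t ht
        have hsub : Icc 0 t ⊆ Icc 0 (K + 1) := Icc_subset_Icc_right (by linarith [ht.2])
        exact hf.clamped_solution_unique hb (hx0.trans hg0.symm)
          (fun s hs => (hx s (hsub hs)).mono hsub)
          (hsol.clamped ht.2 fun s hs e => (hgb s ⟨hs.1, hs.2.trans ht.2.le⟩ e).le)
          ⟨ht.1, le_rfl⟩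
      refine hIco.of_subset_closure (hxc.mono (Icc_subset_Icc_right (by linarith))) hg
        Ico_subset_Icc_self ?_
      rw [closure_Ico hK'.ne]
  have hev : ∀ᶠ t in 𝓝[Icc 0 (K + 1)] K, ∀ e, x t e < b e := by
    refine eventually_all.2 fun e => ?_
    have hK1 : K ∈ Icc 0 (K + 1) := ⟨hK, by linarith⟩
    refine (continuousOn_pi.1 hxc e K hK1).eventually_lt_const ?_
    simpa only [heq ⟨hK, le_rfl⟩] using hgb K ⟨hK, le_rfl⟩ e
  obtain ⟨δ, hδ, hball⟩ := Metric.mem_nhdsWithin_iff.1 hev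
  have hδ1 : 0 < min δ 1 := lt_min hδ one_pos
  refine ⟨K + min δ 1, by linarith, x, hx0, fun t ht => ?_⟩
  rw [timeInterval_coe] at ht ⊢
  have hsub : Ico 0 (K + min δ 1) ⊆ Icc 0 (K + 1) := fun s hs =>
    ⟨hs.1, hs.2.le.trans (by gcongr; exact min_le_right _ _)⟩
  have hlt : ∀ e, x t e < b e := by
    rcases le_or_gt t K with h | h
    · rw [heq ⟨ht.1, h⟩]
      exact hgb t ⟨ht.1, h⟩
    · refine hball ⟨?_, hsub ht⟩
      rw [Metric.mem_ball, Real.dist_eq, abs_of_pos (by linarith)]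
      linarith [ht.2, min_le_left δ 1]
  have hnn : ∀ e, 0 ≤ x t e := hf.clamped_solution_nonneg hb
    (fun e => by rw [hx0, ← hg0]; exact (hm 0 ⟨le_rfl, hK⟩ e).1) hx (hsub ht)
  refine ⟨fun e => ⟨hnn e, (hlt e).trans (hb e).2⟩, ?_⟩
  have := (hx t (hsub ht)).mono hsub
  rwa [FlowFamily.clampedField, clamp_eq_self fun e => ⟨hnn e, (hlt e).le⟩] at this

/-! ### The maximal solution -/

theorem FlowFamily.IsSolution.hasDerivAt {f : N.FlowFamily} {r₀ : E → ℝ} {T : ℝ}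
    {ρ : ℝ → E → ℝ} (h : f.IsSolution r₀ T ρ) {t : ℝ} (ht : t ∈ Ioo 0 T) :
    HasDerivAt ρ (f.field (ρ t)) t := by
  have := h.2 t (by rw [timeInterval_coe]; exact Ioo_subset_Ico_self ht)
  rw [timeInterval_coe] at this
  exact this.2.hasDerivAt (Ico_mem_nhds ht.1 ht.2)

/-- The links that leave a cut fill up at least at the excess rate, which bounds the times up to
which a solution exists. -/
theorem FlowFamily.IsRoutingPolicy.mul_cutInflow_sub_le {f : N.FlowFamily}
    (hf : f.IsRoutingPolicy) {r₀ : E → ℝ} {T : ℝ} {ρ : ℝ → E → ℝ} (h : f.IsSolution r₀ T ρ)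
    {U : Finset V} (hU : ∀ v ∈ U, ¬ N.IsDest v) {t : ℝ} (ht : t ∈ Ico 0 T) :
    t * (N.cutInflow U - ∑ e with N.source e ∈ U ∧ N.target e ∉ U, (N.cap e).toReal) ≤
      ∑ e ∈ N.linksFrom U, (N.buffer e - r₀ e) := by
  set c := N.cutInflow U - ∑ e with N.source e ∈ U ∧ N.target e ∉ U, (N.cap e).toReal
  have hs := h.2
  rw [timeInterval_coe] at hs
  have hd : ∀ s ∈ Ico 0 T, HasDerivWithinAt
      (fun s => ∑ e ∈ N.linksFrom U, ρ s e - s * c)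
      (∑ e ∈ N.linksFrom U, f.field (ρ s) e - 1 * c) (Ico 0 T) s := fun s hs' =>
    (HasDerivWithinAt.fun_sum fun e _ => hasDerivWithinAt_pi.1 (hs s hs').2 e).sub
      ((hasDerivWithinAt_id s _).mul_const c)
  have hmono := monotoneOn_of_hasDerivWithinAt_nonneg (convex_Ico 0 T)
    (fun s hs' => (hd s hs').continuousWithinAt)
    (fun s hs' => (hd s (interior_subset hs')).mono interior_subset)
    (fun s hs' => by
      have := hf.cutInflow_sub_le_sum_field (hs s (interior_subset hs')).1 hU
      linarith)
  have h1 := hmono ⟨le_rfl, ht.1.trans_lt ht.2⟩ ht ht.1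
  have h2 : ∑ e ∈ N.linksFrom U, ρ t e ≤ ∑ e ∈ N.linksFrom U, N.buffer e :=
    Finset.sum_le_sum fun e _ => ((hs t ht).1 e).2.le
  simp only [h.1, zero_mul, sub_zero] at h1
  rw [Finset.sum_sub_distrib]
  linarith

/-- The times up to which a solution exists have a supremum `K`, if they are bounded, and there is
a solution on `[0, K)`: by uniqueness, the solutions on the shorter intervals fit together. -/
theorem FlowFamily.IsRoutingPolicy.exists_maximal_solution {f : N.FlowFamily}
    (hf : f.IsRoutingPolicy) {r₀ : E → ℝ} (hr₀ : r₀ ∈ N.stateSpace)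
    (hbdd : BddAbove {T : ℝ | ∃ ρ, f.IsSolution r₀ T ρ}) :
    ∃ K : ℝ, 0 < K ∧ (∀ T : ℝ, (∃ ρ, f.IsSolution r₀ T ρ) → T ≤ K) ∧
      ∃ ρ, f.IsSolution r₀ K ρ := by
  obtain ⟨T₀, hT₀, hA⟩ : ∃ T : ℝ, 0 < T ∧ ∃ ρ, f.IsSolution r₀ T ρ :=
    hf.exists_isSolution_extend le_rfl (g := fun _ => r₀) continuousOn_const (fun _ _ => hr₀) rfl
      ⟨rfl, fun t ht => absurd (ht.1.trans_lt (EReal.coe_lt_coe_iff.1 ht.2)) (lt_irrefl 0)⟩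
  set A := {T : ℝ | ∃ ρ, f.IsSolution r₀ T ρ}
  have hK : 0 < sSup A := hT₀.trans_le (le_csSup hbdd hA)
  refine ⟨sSup A, hK, fun T hT => le_csSup hbdd hT, ?_⟩
  have hex : ∀ t : ℝ, ∃ (T : ℝ) (ρ : ℝ → E → ℝ), t < sSup A → t < T ∧ f.IsSolution r₀ T ρ := by
    intro t
    by_cases ht : t < sSup A
    · obtain ⟨T, ⟨ρ, hρ⟩, hT⟩ := exists_lt_of_lt_csSup ⟨T₀, hA⟩ ht
      exact ⟨T, ρ, fun _ => ⟨hT, hρ⟩⟩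
    · exact ⟨0, 0, fun h => absurd h ht⟩
  choose T σ hσ using hex
  have heq : ∀ t < sSup A, ∀ s ∈ Ico 0 (sSup A), s < T t → σ s s = σ t s := by
    intro t ht s hs hsT
    have hm : (((min (T s) (T t) : ℝ)) : EReal) ≤ T s ∧
        (((min (T s) (T t) : ℝ)) : EReal) ≤ T t :=
      ⟨EReal.coe_le_coe_iff.2 (min_le_left _ _), EReal.coe_le_coe_iff.2 (min_le_right _ _)⟩
    exact hf.isSolution_unique ((hσ s hs.2).2.mono hm.1) ((hσ t ht).2.mono hm.2)
      ⟨hs.1, lt_min (hσ s hs.2).1 hsT⟩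
  refine ⟨fun t => σ t t, (hσ 0 hK).2.1, fun t ht => ?_⟩
  rw [timeInterval_coe] at ht ⊢
  obtain ⟨htT, hsol⟩ := hσ t ht.2
  have ht' := hsol.2 t (by rw [timeInterval_coe]; exact ⟨ht.1, htT⟩)
  rw [timeInterval_coe] at ht'
  have hnear : ∀ᶠ s in 𝓝[Ico 0 (sSup A)] t, s ∈ Ico 0 (sSup A) ∧ s < T t :=
    eventually_mem_nhdsWithin.and (eventually_nhdsWithin_of_eventually_nhds (eventually_lt_nhds htT))
  refine ⟨ht'.1, HasDerivWithinAt.congr_of_eventuallyEq (ht'.2.mono_of_mem_nhdsWithin ?_)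
    (hnear.mono fun s hs => heq t ht.2 s hs.1 hs.2) rfl⟩
  filter_upwards [hnear] with s hs using ⟨hs.1.1, hs.2⟩

/-- The flows are bounded, so a solution on a bounded interval is Lipschitz and has a limit at the
end. -/
theorem FlowFamily.IsRoutingPolicy.exists_continuous_extension {f : N.FlowFamily}
    (hf : f.IsRoutingPolicy) {r₀ : E → ℝ} {K : ℝ} {ρ : ℝ → E → ℝ}
    (h : f.IsSolution r₀ K ρ) : ∃ g : ℝ → E → ℝ, Continuous g ∧ EqOn ρ g (Ico 0 K) := by
  have hs := h.2
  rw [timeInterval_coe] at hs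
  obtain ⟨M, hM⟩ := hf.exists_norm_field_le
  obtain ⟨g, hg, heq⟩ := LipschitzOnWith.extend_pi
    ((convex_Ico 0 K).lipschitzOnWith_of_nnnorm_hasDerivWithin_le (C := M.toNNReal)
      (fun t ht => (hs t ht).2)
      fun t ht => by
        rw [← NNReal.coe_le_coe, coe_nnnorm]
        exact (hM _ (hs t ht).1).trans (Real.le_coe_toNNReal M))
  exact ⟨g, hg.continuous, heq⟩

end

section

variable {V E : Type*} {N : FlowNetwork V E}

/-! ### Flows near a state with full links -/

/-- The state `r` with the links that are full at `r'` filled up. -/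
def saturate (N : FlowNetwork V E) (r' r : E → ℝ) : E → ℝ :=
  fun e => if r' e = N.buffer e then N.buffer e else r e

theorem saturate_of_full {r' : E → ℝ} (r : E → ℝ) {e : E} (h : r' e = N.buffer e) :
    N.saturate r' r e = N.buffer e := if_pos h

theorem saturate_mem_localDomain {i : N.InLink} {r' r : E → ℝ}
    (hr' : (fun k : N.Local i => r' k.1) ∈ N.localDomain i) (hr : r ∈ N.stateSpace) :
    (fun k : N.Local i => N.saturate r' r k.1) ∈ N.localDomain i := by
  refine restrict_mem_localDomain (fun e => ?_) fun hi => ?_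
  · unfold saturate
    split_ifs
    · exact ⟨(N.buffer_pos e).le, le_rfl⟩
    · exact ⟨(hr e).1, (hr e).2.le⟩
  · obtain ⟨k, hk⟩ := hr'.2 hi
    refine ⟨k.1, k.2, ?_⟩
    rw [saturate, if_neg hk]
    exact (hr k.1).2.ne

theorem tendsto_saturate {r' : E → ℝ} {l : Filter ℝ} {ρ : ℝ → E → ℝ}
    (hρ : Tendsto ρ l (𝓝 r')) : Tendsto (fun t => N.saturate r' (ρ t)) l (𝓝 r') := by
  refine tendsto_pi_nhds.2 fun e => ?_
  unfold saturate
  split_ifs with h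
  · exact h ▸ tendsto_const_nhds
  · exact tendsto_pi_nhds.1 hρ e

variable [Fintype E]

/-- The total free space, at the state `r`, on the links that are full at `r'`. -/
def deficit (N : FlowNetwork V E) (r' r : E → ℝ) : ℝ :=
  ∑ e with r' e = N.buffer e, (N.buffer e - r e)

theorem norm_sub_saturate_le {r' r : E → ℝ} (hr : r ∈ N.stateSpace) (e : E) :
    ‖r e - N.saturate r' r e‖ ≤ N.deficit r' r := by
  have hnn : ∀ e, 0 ≤ N.buffer e - r e := fun e => by linarith [(hr e).2]
  unfold saturate
  split_ifs with h
  · rw [norm_sub_rev, Real.norm_of_nonneg (hnn e)]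
    exact Finset.single_le_sum (f := fun e => N.buffer e - r e) (fun e _ => hnn e) (by simpa using h)
  · rw [sub_self, norm_zero]
    exact Finset.sum_nonneg fun e _ => hnn e

variable [Fintype V]

theorem _root_.LocallyLipschitzOn.isBigO_sub {α F G : Type*} [SeminormedAddCommGroup F]
    [SeminormedAddCommGroup G] {s : Set F} {φ : F → G} (hφ : LocallyLipschitzOn s φ) {l : Filter α}
    {x y : α → F} {z : F} (hz : z ∈ s) (hx : Tendsto x l (𝓝 z)) (hy : Tendsto y l (𝓝 z))
    (hxs : ∀ᶠ t in l, x t ∈ s) (hys : ∀ᶠ t in l, y t ∈ s) :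
    (fun t => φ (x t) - φ (y t)) =O[l] fun t => x t - y t := by
  obtain ⟨K, W, hW, hK⟩ := hφ hz
  refine Asymptotics.IsBigO.of_bound K ?_
  filter_upwards [tendsto_nhdsWithin_iff.2 ⟨hx, hxs⟩ hW, tendsto_nhdsWithin_iff.2 ⟨hy, hys⟩ hW]
    with t h1 h2
  exact hK.norm_sub_le h1 h2

/-- Where the flow functions of `i` are defined at the limit state, filling up the links that are
full in the limit changes the flows out of `i` by a multiple of the deficit at most. -/
theorem FlowFamily.IsRoutingPolicy.isBigO_flow_sub {f : N.FlowFamily} (hf : f.IsRoutingPolicy)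
    {i : N.InLink} {r' : E → ℝ} {l : Filter ℝ} {ρ : ℝ → E → ℝ}
    (hr' : (fun k : N.Local i => r' k.1) ∈ N.localDomain i)
    (hρ : Tendsto ρ l (𝓝 r')) (hm : ∀ᶠ t in l, ρ t ∈ N.stateSpace) (j : N.Down i) :
    (fun t => f i (fun k => ρ t k.1) j - f i (fun k => N.saturate r' (ρ t) k.1) j) =O[l]
      fun t => N.deficit r' (ρ t) := by
  have hrestr : ∀ {x : ℝ → E → ℝ}, Tendsto x l (𝓝 r') →
      Tendsto (fun t (k : N.Local i) => x t k.1) l (𝓝 fun k => r' k.1) := fun hx =>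
    tendsto_pi_nhds.2 fun k => tendsto_pi_nhds.1 hx k.1
  have h := (hf.locallyLipschitzOn i).isBigO_sub hr' (hrestr hρ) (hrestr (tendsto_saturate hρ))
    (hm.mono fun t ht => restrict_mem_localDomain_of_mem_stateSpace i ht)
    (hm.mono fun t ht => saturate_mem_localDomain hr' ht)
  refine (Asymptotics.isBigO_pi.1 h j).trans (Asymptotics.IsBigO.of_bound 1 ?_)
  filter_upwards [hm] with t ht
  have hnn : 0 ≤ N.deficit r' (ρ t) :=
    Finset.sum_nonneg fun e _ => by linarith [(ht e).2]
  rw [one_mul, Real.norm_of_nonneg hnn]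
  exact (pi_norm_le_iff_of_nonneg hnn).2 fun k => norm_sub_saturate_le ht k.1

theorem FlowFamily.IsRoutingPolicy.isBigO_outflow_sub {f : N.FlowFamily} (hf : f.IsRoutingPolicy)
    {i : N.InLink} {r' : E → ℝ} {l : Filter ℝ} {ρ : ℝ → E → ℝ}
    (hr' : (fun k : N.Local i => r' k.1) ∈ N.localDomain i)
    (hρ : Tendsto ρ l (𝓝 r')) (hm : ∀ᶠ t in l, ρ t ∈ N.stateSpace) :
    (fun t => f.outflow i (fun k => ρ t k.1) -
      f.outflow i (fun k => N.saturate r' (ρ t) k.1)) =O[l] fun t => N.deficit r' (ρ t) := by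
  simp only [outflow, ← Finset.sum_sub_distrib]
  exact Asymptotics.IsBigO.fun_sum fun j _ => hf.isBigO_flow_sub hr' hρ hm j

/-- A link that is not full in the limit, while all links downstream of it are, releases a flow
that is at most a multiple of the deficit. -/
theorem FlowFamily.IsRoutingPolicy.isBigO_outflow_of_blocked {f : N.FlowFamily}
    (hf : f.IsRoutingPolicy) {r' : E → ℝ} {l : Filter ℝ} {ρ : ℝ → E → ℝ}
    (hbox : ∀ e, 0 ≤ r' e ∧ r' e ≤ N.buffer e)
    (hρ : Tendsto ρ l (𝓝 r')) (hm : ∀ᶠ t in l, ρ t ∈ N.stateSpace) {e : E}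
    (he : r' e ≠ N.buffer e) (hdest : ¬ N.IsDest (N.target e))
    (hdown : ∀ k, N.source k = N.target e → r' k = N.buffer k) :
    (fun t => f.outflow (Sum.inl e) (fun k => ρ t k.1)) =O[l] fun t => N.deficit r' (ρ t) := by
  have hr' : (fun k : N.Local (Sum.inl e) => r' k.1) ∈ N.localDomain (Sum.inl e) :=
    restrict_mem_localDomain hbox fun _ => ⟨e, Or.inl rfl, he⟩
  refine (hf.isBigO_outflow_sub hr' hρ hm).congr' ?_ EventuallyEq.rfl
  filter_upwards [hm] with t ht
  rw [sub_eq_self]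
  refine Finset.sum_eq_zero ?_
  rintro ⟨k | d, hk⟩ -
  · exact hf.flow_to_full _ k hk _ (saturate_mem_localDomain hr' ht)
      (saturate_of_full _ (hdown k hk))
  · exact absurd (show N.IsDest (N.target e) from (show d.1 = N.target e from hk) ▸ d.2) hdest

/-- A link that becomes full, at a node that keeps a link with free space, receives a flow that
is at most a multiple of the deficit. -/
theorem FlowFamily.IsRoutingPolicy.isBigO_inflowTo_of_full {f : N.FlowFamily}
    (hf : f.IsRoutingPolicy) {r' : E → ℝ} {l : Filter ℝ} {ρ : ℝ → E → ℝ}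
    (hbox : ∀ e, 0 ≤ r' e ∧ r' e ≤ N.buffer e)
    (hρ : Tendsto ρ l (𝓝 r')) (hm : ∀ᶠ t in l, ρ t ∈ N.stateSpace) {e k : E}
    (he : r' e = N.buffer e) (hke : N.source k = N.source e) (hk : r' k ≠ N.buffer k) :
    (fun t => f.inflowTo (ρ t) e) =O[l] fun t => N.deficit r' (ρ t) := by
  refine Asymptotics.IsBigO.fun_sum fun i _ => ?_
  have hr' : (fun k : N.Local i.1 => r' k.1) ∈ N.localDomain i.1 :=
    restrict_mem_localDomain hbox fun _ => ⟨k, Or.inr (hke.trans i.2.symm), hk⟩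
  refine (hf.isBigO_flow_sub hr' hρ hm ⟨Sum.inl e, i.2.symm⟩).congr' ?_ EventuallyEq.rfl
  filter_upwards [hm] with t ht
  rw [sub_eq_self]
  exact hf.flow_to_full _ e i.2.symm _ (saturate_mem_localDomain hr' ht) (saturate_of_full _ he)

/-- A link that becomes full and leads to a destination, or to a node that keeps a link with free
space, releases its flow capacity up to a multiple of the deficit. -/
theorem FlowFamily.IsRoutingPolicy.isBigO_cap_sub_outflow {f : N.FlowFamily}
    (hf : f.IsRoutingPolicy) {r' : E → ℝ} {l : Filter ℝ} {ρ : ℝ → E → ℝ}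
    (hbox : ∀ e, 0 ≤ r' e ∧ r' e ≤ N.buffer e)
    (hρ : Tendsto ρ l (𝓝 r')) (hm : ∀ᶠ t in l, ρ t ∈ N.stateSpace) {e : E}
    (he : r' e = N.buffer e)
    (hdown : ¬ N.IsDest (N.target e) → ∃ k, N.source k = N.target e ∧ r' k ≠ N.buffer k) :
    (fun t => (N.cap e).toReal - f.outflow (Sum.inl e) (fun k => ρ t k.1)) =O[l]
      fun t => N.deficit r' (ρ t) := by
  have hr' : (fun k : N.Local (Sum.inl e) => r' k.1) ∈ N.localDomain (Sum.inl e) :=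
    restrict_mem_localDomain hbox fun hd =>
      let ⟨k, hk, hne⟩ := hdown hd
      ⟨k, Or.inr hk, hne⟩
  refine (hf.isBigO_outflow_sub hr' hρ hm).neg_left.congr' ?_ EventuallyEq.rfl
  filter_upwards [hm] with t ht
  have h := hf.outflow_full e _ (saturate_mem_localDomain hr' ht) (saturate_of_full _ he)
  rw [neg_sub, ← h, EReal.toReal_coe]

/-! ### The congested cut -/

/-- The congested nodes at the state `r'`: the non-destinations all of whose outgoing links are
full. -/
def congested (N : FlowNetwork V E) (r' : E → ℝ) : Finset V :=
  {v | ¬ N.IsDest v ∧ ∀ e, N.source e = v → r' e = N.buffer e}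

theorem mem_congested {r' : E → ℝ} {v : V} : v ∈ N.congested r' ↔
    ¬ N.IsDest v ∧ ∀ e, N.source e = v → r' e = N.buffer e := by
  simp [congested]

theorem exists_not_full {r' : E → ℝ} {v : V} (hd : ¬ N.IsDest v) (h : v ∉ N.congested r') :
    ∃ k, N.source k = v ∧ r' k ≠ N.buffer k := by
  rw [mem_congested] at h
  push Not at h
  exact h hd

/-- Up to a multiple of the deficit, the links that become full gain at most the excess of the
external inflow of the congested nodes over their capacity. -/
theorem FlowFamily.IsRoutingPolicy.exists_sum_field_le {f : N.FlowFamily}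
    (hf : f.IsRoutingPolicy) {r' : E → ℝ} {l : Filter ℝ} {ρ : ℝ → E → ℝ}
    (hbox : ∀ e, 0 ≤ r' e ∧ r' e ≤ N.buffer e)
    (hρ : Tendsto ρ l (𝓝 r')) (hm : ∀ᶠ t in l, ρ t ∈ N.stateSpace) :
    ∃ c : ℝ, ∀ᶠ t in l, ∑ e with r' e = N.buffer e, f.field (ρ t) e ≤
      N.cutInflow (N.congested r') - (∑ e with N.source e ∈ N.congested r' ∧
        N.target e ∉ N.congested r', (N.cap e).toReal) + c * N.deficit r' (ρ t) := by
  set S := N.congested r'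
  have hSd : ∀ v ∈ S, ¬ N.IsDest v := fun v hv => (mem_congested.1 hv).1
  have hfull : ∀ e, N.source e ∈ S → r' e = N.buffer e := fun e he =>
    (mem_congested.1 he).2 e rfl
  have hR1 : (fun t => ∑ e with N.target e ∈ S ∧ r' e ≠ N.buffer e,
      f.outflow (Sum.inl e) (fun k => ρ t k.1)) =O[l] fun t => N.deficit r' (ρ t) := by
    refine Asymptotics.IsBigO.fun_sum fun e he => ?_
    obtain ⟨h1, h2⟩ := (Finset.mem_filter.1 he).2
    exact hf.isBigO_outflow_of_blocked hbox hρ hm h2 (hSd _ h1) (mem_congested.1 h1).2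
  have hR2 : (fun t => ∑ e with r' e = N.buffer e ∧ N.source e ∉ S,
      f.inflowTo (ρ t) e) =O[l] fun t => N.deficit r' (ρ t) := by
    refine Asymptotics.IsBigO.fun_sum fun e he => ?_
    obtain ⟨h1, h2⟩ := (Finset.mem_filter.1 he).2
    obtain ⟨k, hk, hne⟩ := exists_not_full (fun hd => hd e rfl) h2
    exact hf.isBigO_inflowTo_of_full hbox hρ hm h1 hk hne
  have hR3 : (fun t => ∑ e with N.source e ∈ S ∧ N.target e ∉ S,
      ((N.cap e).toReal - f.outflow (Sum.inl e) (fun k => ρ t k.1))) =O[l]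
      fun t => N.deficit r' (ρ t) := by
    refine Asymptotics.IsBigO.fun_sum fun e he => ?_
    obtain ⟨h1, h2⟩ := (Finset.mem_filter.1 he).2
    exact hf.isBigO_cap_sub_outflow hbox hρ hm (hfull e h1) fun hd => exists_not_full hd h2
  obtain ⟨c, hc⟩ := ((hR1.add hR2).add hR3).bound
  refine ⟨c, ?_⟩
  filter_upwards [hc, hm] with t ht hmt
  have hnn : 0 ≤ N.deficit r' (ρ t) :=
    Finset.sum_nonneg fun e _ => by linarith [(hmt e).2]
  rw [Real.norm_of_nonneg hnn] at ht
  have ht' := (Real.le_norm_self _).trans ht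
  rw [Finset.sum_sub_distrib] at ht'
  have ho : ∀ e, 0 ≤ f.outflow (Sum.inl e) (fun k => ρ t k.1) := fun e =>
    hf.outflow_nonneg _ (restrict_mem_localDomain_of_mem_stateSpace _ hmt)
  -- Congested nodes have only full outgoing links, so mass balance applies to a part of the sum.
  have hin : ∑ e with r' e = N.buffer e, f.inflowTo (ρ t) e =
      ∑ e with N.target e ∈ S, f.outflow (Sum.inl e) (fun k => ρ t k.1) + N.cutInflow S +
        ∑ e with r' e = N.buffer e ∧ N.source e ∉ S, f.inflowTo (ρ t) e := by
    rw [← hf.sum_inflowTo hmt hSd, ← Finset.sum_filter_add_sum_filter_not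
      (Finset.univ.filter fun e => r' e = N.buffer e) (fun e => N.source e ∈ S),
      Finset.filter_filter, Finset.filter_filter, linksFrom]
    congr 2
    ext e
    simpa using hfull e
  have hsplit := Finset.sum_filter_add_sum_filter_not
    (Finset.univ.filter fun e => N.target e ∈ S) (fun e => r' e = N.buffer e)
    (fun e => f.outflow (Sum.inl e) (fun k => ρ t k.1))
  rw [Finset.filter_filter, Finset.filter_filter] at hsplit
  -- The full links that neither enter nor leave `S` are dropped, since they release something
  -- nonnegative.
  have hout : ∑ e with N.target e ∈ S ∧ r' e = N.buffer e,
        f.outflow (Sum.inl e) (fun k => ρ t k.1) +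
      ∑ e with N.source e ∈ S ∧ N.target e ∉ S, f.outflow (Sum.inl e) (fun k => ρ t k.1) ≤
      ∑ e with r' e = N.buffer e, f.outflow (Sum.inl e) (fun k => ρ t k.1) := by
    rw [← Finset.sum_union]
    · refine Finset.sum_le_sum_of_subset_of_nonneg (fun e he => ?_) fun e _ _ => ho e
      simp only [Finset.mem_union, Finset.mem_filter, Finset.mem_univ, true_and] at he ⊢
      exact he.elim (fun h => h.2) fun h => hfull e h.1
    · refine Finset.disjoint_left.2 fun e h1 h2 => ?_
      simp only [Finset.mem_filter, Finset.mem_univ, true_and] at h1 h2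
      exact h2.2 h1.1
  simp only [field, Finset.sum_sub_distrib]
  rw [hin]
  linarith

/-- A positive function whose logarithmic derivative is bounded below does not tend to zero in
finite time. -/
theorem not_tendsto_zero_of_deriv_ge {K c : ℝ} (hK : 0 < K) {m m' : ℝ → ℝ}
    (hpos : ∀ t ∈ Ioo 0 K, 0 < m t) (hd : ∀ t ∈ Ioo 0 K, HasDerivAt m (m' t) t)
    (hbound : ∀ᶠ t in 𝓝[<] K, -(c * m t) ≤ m' t) : ¬ Tendsto m (𝓝[<] K) (𝓝 0) := by
  intro hlim
  obtain ⟨a, ha, hsub⟩ := (mem_nhdsLT_iff_exists_mem_Ico_Ioo_subset hK).1 hbound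
  have hsub0 : ∀ t ∈ Ioo a K, t ∈ Ioo 0 K := fun t ht => ⟨ha.1.trans_lt ht.1, ht.2⟩
  have hexp : ∀ t, HasDerivAt (fun s => Real.exp (c * s)) (Real.exp (c * t) * c) t := fun t => by
    simpa using ((hasDerivAt_id t).const_mul c).exp
  have hd' : ∀ t ∈ Ioo a K, HasDerivAt (fun s => Real.exp (c * s) * m s)
      (Real.exp (c * t) * c * m t + Real.exp (c * t) * m' t) t := fun t ht =>
    (hexp t).mul (hd t (hsub0 t ht))
  have hmono : MonotoneOn (fun s => Real.exp (c * s) * m s) (Ioo a K) := by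
    refine monotoneOn_of_hasDerivWithinAt_nonneg (convex_Ioo a K)
      (f' := fun t => Real.exp (c * t) * c * m t + Real.exp (c * t) * m' t)
      (fun t ht => (hd' t ht).continuousAt.continuousWithinAt)
      (fun t ht => (hd' t (interior_subset ht)).hasDerivWithinAt) fun t ht => ?_
    have h1 : -(c * m t) ≤ m' t := hsub (interior_subset ht)
    have h2 := mul_nonneg (Real.exp_pos (c * t)).le (sub_nonneg.2 h1)
    linarith
  obtain ⟨s, hs⟩ := nonempty_Ioo.2 ha.2
  have hlim' : Tendsto (fun t => Real.exp (c * t) * m t) (𝓝[<] K) (𝓝 (Real.exp (c * K) * 0)) :=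
    ((hexp K).continuousAt.tendsto.mono_left nhdsWithin_le_nhds).mul hlim
  have hge : Real.exp (c * s) * m s ≤ Real.exp (c * K) * 0 := by
    refine ge_of_tendsto hlim' ?_
    filter_upwards [Ioo_mem_nhdsLT hs.2] with t ht
    exact hmono hs ⟨hs.1.trans ht.1, ht.2⟩ ht.1.le
  have := mul_pos (Real.exp_pos (c * s)) (hpos s (hsub0 s hs))
  linarith

/-- If a link becomes full at time `K`, then the external inflow of the congested nodes exceeds
their capacity: otherwise the deficit would decrease at a rate proportional to itself at most, and
could not reach zero. -/
theorem FlowFamily.IsRoutingPolicy.congested_violated {f : N.FlowFamily}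
    (hf : f.IsRoutingPolicy) {r₀ r' : E → ℝ} {K : ℝ} (hK : 0 < K) {ρ : ℝ → E → ℝ}
    (hsol : f.IsSolution r₀ K ρ) (hbox : ∀ e, 0 ≤ r' e ∧ r' e ≤ N.buffer e)
    (hρ : Tendsto ρ (𝓝[<] K) (𝓝 r')) {e₀ : E} (he₀ : r' e₀ = N.buffer e₀) :
    ∑ e with N.source e ∈ N.congested r' ∧ N.target e ∉ N.congested r', (N.cap e).toReal <
      N.cutInflow (N.congested r') := by
  by_contra! hle
  have hm : ∀ t ∈ Ioo 0 K, ρ t ∈ N.stateSpace := fun t ht =>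
    (hsol.2 t (by rw [timeInterval_coe]; exact Ioo_subset_Ico_self ht)).1
  obtain ⟨c, hc⟩ := hf.exists_sum_field_le hbox hρ
    (eventually_of_mem (Ioo_mem_nhdsLT hK) hm)
  refine not_tendsto_zero_of_deriv_ge hK (c := c) (m := fun t => N.deficit r' (ρ t))
    (m' := fun t => ∑ e with r' e = N.buffer e, (0 - f.field (ρ t) e)) (fun t ht => ?_)
    (fun t ht => ?_) ?_ ?_
  · refine Finset.sum_pos (fun e _ => ?_) ⟨e₀, by simpa using he₀⟩
    linarith [(hm t ht e).2]
  · exact HasDerivAt.fun_sum fun e _ =>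
      (hasDerivAt_const t (N.buffer e)).sub (hasDerivAt_pi.1 (hsol.hasDerivAt ht) e)
  · filter_upwards [hc] with t ht
    simp only [zero_sub, Finset.sum_neg_distrib]
    linarith
  · have h0 : N.deficit r' r' = 0 := Finset.sum_eq_zero fun e he => by
      rw [(Finset.mem_filter.1 he).2, sub_self]
    rw [← h0]
    exact tendsto_finsetSum _ fun e _ => (tendsto_pi_nhds.1 hρ e).const_sub _

/-- A solution that cannot be continued beyond `K` fills up a link at `K`. -/
theorem FlowFamily.IsRoutingPolicy.exists_full_of_maximal {f : N.FlowFamily}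
    (hf : f.IsRoutingPolicy) {r₀ : E → ℝ} {K : ℝ} (hK : 0 < K) {g : ℝ → E → ℝ}
    (hsol : f.IsSolution r₀ K g) (hg : Continuous g)
    (hmax : ∀ T : ℝ, (∃ ρ, f.IsSolution r₀ T ρ) → T ≤ K) :
    (∀ e, 0 ≤ g K e ∧ g K e ≤ N.buffer e) ∧ ∃ e, g K e = N.buffer e := by
  have hs := hsol.2
  rw [timeInterval_coe] at hs
  have hlim : ∀ e, Tendsto (fun t => g t e) (𝓝[<] K) (𝓝 (g K e)) := fun e =>
    ((continuous_pi_iff.1 hg e).tendsto K).mono_left nhdsWithin_le_nhds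
  have hIco : ∀ᶠ t in 𝓝[<] K, t ∈ Ico 0 K := Ico_mem_nhdsLT hK
  have hbox : ∀ e, 0 ≤ g K e ∧ g K e ≤ N.buffer e := fun e =>
    ⟨ge_of_tendsto (hlim e) (hIco.mono fun t ht => ((hs t ht).1 e).1),
      le_of_tendsto (hlim e) (hIco.mono fun t ht => ((hs t ht).1 e).2.le)⟩
  refine ⟨hbox, ?_⟩
  by_contra! hne
  obtain ⟨T, hT, hex⟩ := hf.exists_isSolution_extend hK.le hg.continuousOn
    (fun t ht => by
      rcases ht.2.eq_or_lt with rfl | h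
      · exact fun e => ⟨(hbox e).1, (hbox e).2.lt_of_ne (hne e)⟩
      · exact (hs t ⟨ht.1, h⟩).1) hsol.1 hsol
  exact absurd (hmax T hex) (not_le.2 hT)

end

end FlowNetwork

end

theorem proposition1 {V E : Type*} [Fintype V] [Fintype E] (N : FlowNetwork V E)
    (hconn : N.Connected) (f : N.FlowFamily) (hf : f.IsRoutingPolicy) (hmono : f.IsMonotone)
    (hviol : N.violatedCuts.Nonempty) (r₀ : E → ℝ) (hr₀ : r₀ ∈ N.stateSpace) :
    ∃ K : ℝ, 0 < K ∧ f.exitTime r₀ = (K : EReal) ∧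
      (K : EReal) ≤ N.violatedCuts.inf' hviol (fun U =>
        ((∑ e ∈ N.linksFrom U, (N.buffer e - r₀ e) : ℝ) : EReal) /
          ((N.cutInflow U : EReal) - N.cutCap U)) ∧
      ∃ ρ : ℝ → E → ℝ, f.IsSolution r₀ (K : EReal) ρ ∧
        (∀ ρ' : ℝ → E → ℝ, f.IsSolution r₀ (K : EReal) ρ' → ∀ t ∈ Set.Ico 0 K, ρ' t = ρ t) ∧
        ∃ S : Finset V, N.IsCut S ∧ N.cutCap S < (N.cutInflow S : EReal) ∧
          (∀ e, ∀ t ∈ Set.Ico 0 K, ρ t e < N.buffer e) ∧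
          ∀ e ∈ N.linksFrom S, Filter.Tendsto (fun t => ρ t e) (nhdsWithin K (Set.Iio K))
            (nhds (N.buffer e)) := by
  -- Every violated cut bounds the times up to which a solution exists.
  have hbound : ∀ U ∈ N.violatedCuts, 0 < N.cutInflow U -
      ∑ e with N.source e ∈ U ∧ N.target e ∉ U, (N.cap e).toReal ∧
      ∀ T : ℝ, (∃ ρ, f.IsSolution r₀ T ρ) → T ≤ (∑ e ∈ N.linksFrom U, (N.buffer e - r₀ e)) /
        (N.cutInflow U - ∑ e with N.source e ∈ U ∧ N.target e ∉ U, (N.cap e).toReal) := by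
    intro U hU
    obtain ⟨hcut, hlt⟩ := (Finset.mem_filter.1 hU).2
    rw [hf.cutCap_eq, EReal.coe_lt_coe_iff] at hlt
    refine ⟨sub_pos.2 hlt, ?_⟩
    rintro T ⟨ρ, hρ⟩
    rw [le_div_iff₀ (sub_pos.2 hlt)]
    have hnn : 0 ≤ ∑ e ∈ N.linksFrom U, (N.buffer e - r₀ e) :=
      Finset.sum_nonneg fun e _ => by linarith [(hr₀ e).2]
    rcases le_or_gt T 0 with hT | hT
    · exact (mul_nonpos_of_nonpos_of_nonneg hT (sub_pos.2 hlt).le).trans hnn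
    · refine le_of_tendsto (((continuous_mul_const _).tendsto T).mono_left
        (nhdsWithin_le_nhds (s := Iio T))) ?_
      filter_upwards [Ico_mem_nhdsLT hT] with t ht
      exact hf.mul_cutInflow_sub_le hρ hcut.2 ht
  have hbdd : BddAbove {T : ℝ | ∃ ρ, f.IsSolution r₀ T ρ} := by
    obtain ⟨U, hU⟩ := hviol
    exact ⟨_, fun T hT => (hbound U hU).2 T hT⟩
  obtain ⟨K, hK, hmax, ρ, hρ⟩ := hf.exists_maximal_solution hr₀ hbdd
  have hmem := hρ.2
  rw [FlowNetwork.timeInterval_coe] at hmem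
  refine ⟨K, hK, ?_, ?_, ρ, hρ, fun ρ' hρ' t ht => (hf.isSolution_unique hρ hρ' ht).symm, ?_⟩
  · refine le_antisymm (sSup_le ?_) (le_sSup ⟨ρ, hρ⟩)
    rintro T ⟨ρ', hρ'⟩
    induction T with
    | bot => exact bot_le
    | coe T => exact EReal.coe_le_coe_iff.2 (hmax T ⟨ρ', hρ'⟩)
    | top => linarith [hmax (K + 1) ⟨ρ', hρ'.mono le_top⟩]
  · refine Finset.le_inf' _ _ fun U hU => ?_
    rw [hf.cutCap_eq, ← EReal.coe_sub, ← EReal.coe_div, EReal.coe_le_coe_iff]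
    exact (hbound U hU).2 K ⟨ρ, hρ⟩
  · obtain ⟨g, hg, heq⟩ := hf.exists_continuous_extension hρ
    have hgsol : f.IsSolution r₀ K g := by
      refine ⟨(heq ⟨le_rfl, hK⟩).symm.trans hρ.1, ?_⟩
      rw [FlowNetwork.timeInterval_coe]
      intro t ht
      rw [← heq ht]
      exact ⟨(hmem t ht).1, (hmem t ht).2.congr (fun s hs => (heq hs).symm) (heq ht).symm⟩
    obtain ⟨hbox, e₀, he₀⟩ := hf.exists_full_of_maximal hK hgsol hg hmax
    have hlim : Tendsto ρ (𝓝[<] K) (𝓝 (g K)) :=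
      ((hg.tendsto K).mono_left nhdsWithin_le_nhds).congr' <| by
        filter_upwards [Ico_mem_nhdsLT hK] with t ht using (heq ht).symm
    have hS := hf.congested_violated hK hρ hbox hlim he₀
    refine ⟨N.congested (g K), ⟨?_, fun v hv => (FlowNetwork.mem_congested.1 hv).1⟩, ?_,
      fun e t ht => ((hmem t ht).1 e).2, fun e he => ?_⟩
    · by_contra hne
      rw [Finset.not_nonempty_iff_eq_empty] at hne
      simp [hne, FlowNetwork.cutInflow] at hS
    · rw [hf.cutCap_eq]
      exact EReal.coe_lt_coe_iff.2 hS
    · rw [← (FlowNetwork.mem_congested.1 (Finset.mem_filter.1 he).2).2 e rfl]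
      exact tendsto_pi_nhds.1 hlim e
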